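/- Let $\{c(r): r\in\mathbb{Z}\}$ be a real, symmetric ($c(-r)=c(r)$), positive definite sequence whose Fourier transform $f(\omega)=\sum_{r\in\mathbb{Z}}c(r)e^{ir\omega}$ (convergent in $L_2([0,2\pi))$) satisfies $0<\inf_\omega f(\omega)\le\sup_\omega f(\omega)<\infty$ (essential infimum and supremum). Then there are a unique number $\sigma^2>0$ and unique real square summable sequences $(\psi_j)_{j\ge1}$, $(\phi_j)_{j\ge1}$ such that, with $\psi(\omega)=1+\sum_{j=1}^\infty\psi_je^{ij\omega}$ and $\phi(\omega)=1-\sum_{j=1}^\infty\phi_je^{ij\omega}$, $$\phi(\omega)=\psi(\omega)^{-1}\quad\text{and}\quad f(\omega)=\sigma^2|\psi(\omega)|^2=\sigma^2|\phi(\omega)|^{-2}\quad\text{for almost every }\omega.$$ For $\ell\ge0$ put $\phi_\ell(\omega)=\sum_{s=1}^\infty\phi_{\ell+s}e^{is\omega}$, and let $^*$ denote complex conjugation. Let $(g_\ell)_{\ell\ge0}$ be a square summable sequence of complex numbers. Then the semi-infinite Wiener–Hopf system $$g_\ell=\sum_{j=0}^\infty h_j\,c(\ell-j),\qquad \ell\ge0,$$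 has exactly one square summable complex solution $(h_j)_{j\ge0}$, and its Fourier transform $H(\omega)=\sum_{j=0}^\infty h_je^{ij\omega}$ satisfies, for almost every $\omega$, $$H(\omega)=\frac{\sum_{\ell=0}^\infty g_\ell\bigl(e^{i\ell\omega}+\psi(\omega)^*\phi_\ell(\omega)^*\bigr)}{f(\omega)}$$ and $$H(\omega)=\sigma^{-2}\phi(\omega)\sum_{\ell=0}^\infty g_\ell\Bigl(e^{i\ell\omega}-\sum_{s=1}^{\ell}\phi_s\,e^{i(\ell-s)\omega}\Bigr),$$ where an empty sum is $0$ and all series of functions of $\omega$ converge unconditionally in $L_2([0,2\pi))$. -/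

import Mathlib

open MeasureTheory Filter Topology

/-- The interval `[0, 2π)` with its end points identified. -/
abbrev Torus : Type := AddCircle (2 * Real.pi)

instance factTwoPiPos : Fact (0 < 2 * Real.pi) := ⟨Real.two_pi_pos⟩

/-- Normalised Lebesgue measure `dω / 2π` on `[0, 2π)`. -/
noncomputable abbrev torusMeasure : Measure Torus := AddCircle.haarAddCircle

/-- The exponential `e^{ijω}`. -/
noncomputable def expo (j : ℤ) (ω : Torus) : ℂ := fourier j ω

theorem expo_coe (j : ℤ) (x : ℝ) :
    expo j (x : Torus) = Complex.exp (Complex.I * j * x) := by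
  have h : (Real.pi : ℂ) ≠ 0 := by exact_mod_cast Real.pi_ne_zero
  unfold expo
  rw [fourier_coe_apply]
  congr 1
  push_cast
  field_simp

/-- `A = ∑ i, u i` in `L_2([0, 2π))`: all the functions are square integrable and the finite
partial sums converge (unconditionally) to `A` in the `L_2` norm. -/
def L2HasSum {ι : Type} (u : ι → Torus → ℂ) (A : Torus → ℂ) : Prop :=
  (∀ i, MemLp (u i) 2 torusMeasure) ∧ MemLp A 2 torusMeasure ∧
    Tendsto (fun s : Finset ι => eLpNorm (fun ω => A ω - ∑ i ∈ s, u i ω) 2 torusMeasure)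
      atTop (𝓝 0)

/-- Positive definite (real) sequences, in the usual sense that all the Toeplitz quadratic forms
are non-negative. (When the Fourier transform of `c` is bounded away from zero, they are
automatically strictly positive for `a ≠ 0`, so this is the weaker and harmless form of the
hypothesis.) -/
def IsPositiveDefiniteSeq (c : ℤ → ℝ) : Prop :=
  ∀ (s : Finset ℤ) (a : ℤ → ℝ), 0 ≤ ∑ t ∈ s, ∑ τ ∈ s, a t * a τ * c (t - τ)

/-- The factorization `f(ω) = σ² |ψ(ω)|² = σ² |φ(ω)|⁻²` with `σ² > 0`,
`ψ(ω) = 1 + ∑_{j ≥ 1} ψ_j e^{ijω}` and `φ(ω) = ψ(ω)⁻¹ = 1 - ∑_{j ≥ 1} φ_j e^{ijω}`.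
The lower case sequences hold the coefficients, with the conventions `ψ_0 = 1` and `φ_0 = -1`;
the upper case functions are their transforms. -/
structure IsSpectralFactorization (f : Torus → ℝ) (σsq : ℝ) (ψ φ : ℕ → ℝ)
    (Ψ Φ : Torus → ℂ) : Prop where
  sigma_pos : 0 < σsq
  psi_zero : ψ 0 = 1
  phi_zero : φ 0 = -1
  psi_sum : L2HasSum (fun (j : ℕ) ω => (ψ (j + 1) : ℂ) * expo (j + 1) ω) (fun ω => Ψ ω - 1)
  phi_sum : L2HasSum (fun (j : ℕ) ω => (φ (j + 1) : ℂ) * expo (j + 1) ω) (fun ω => 1 - Φ ω)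
  phi_eq_inv : ∀ᵐ ω ∂torusMeasure, Φ ω * Ψ ω = 1
  eq_psi : ∀ᵐ ω ∂torusMeasure, f ω = σsq * ‖Ψ ω‖ ^ 2
  eq_phi : ∀ᵐ ω ∂torusMeasure, f ω = σsq * (‖Φ ω‖ ^ 2)⁻¹

/-- `φ_ℓ(ω) = ∑_{s ≥ 1} φ_{ℓ+s} e^{isω}` for all `ℓ ≥ 0`, the series converging in `L_2`. -/
def IsARTail (φ : ℕ → ℝ) (φt : ℕ → Torus → ℂ) : Prop :=
  ∀ ℓ : ℕ, L2HasSum (fun (s : ℕ) ω => (φ (ℓ + (s + 1)) : ℂ) * expo (s + 1) ω) (φt ℓ)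

/-- Square summable sequences indexed by `ℕ`. -/
def IsSqSummable (v : ℕ → ℂ) : Prop := Summable fun j => ‖v j‖ ^ 2

/-- The semi-infinite system `g_ℓ = ∑_{j ≥ 0} h_j c(ℓ - j)`, `ℓ ≥ 0`. -/
def SolvesWienerHopf (c : ℤ → ℝ) (g h : ℕ → ℂ) : Prop :=
  ∀ ℓ : ℕ, HasSum (fun j : ℕ => h j * (c ((ℓ : ℤ) - (j : ℤ)) : ℂ)) (g ℓ)

open scoped ENNReal ComplexConjugate InnerProductSpace

/-! Let P be the projection of L² onto the Hardy space of functions without negative frequencies. On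
transforms the system reads P(fH) = G, with H and G in the Hardy space (`solvesWienerHopf_iff`).
Since m ≤ f ≤ M, the operator P(1 - f/M) has norm at most 1 - m/M < 1, so a Neumann series solves
this Toeplitz equation uniquely (`existsUnique_toeplitz`).

The same equation produces the factorization. Solve P(fu) = 1. For k > 0 the k-th coefficient of
f|u|² is ⟨e_k u, fu⟩ = 0, because e_k u lives on frequencies ≥ k, where fu has none. As f|u|² is
real, it is a constant C > 0 (`toeplitz_mul_norm_sq`), and Φ = u/C, Ψ = (fu)*, σ² = 1/C is a
factorization. Conversely, any factorization has fΦ = σ²Ψ*, so P(fΦ/σ²) = PΨ* = 1, and unique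
solvability forces uniqueness.

Multiplication by Ψ* preserves ker P, so H = σ⁻²ΦP(Φ*G) satisfies P(fH) = P(Ψ*P(Φ*G)) = P(Ψ*Φ*G) = G
(`toeplitz_solution`). Evaluating the bounded operators PΦ* and Ψ*PΦ* on each e^{iℓω} gives the two
series for H. -/

/-- The Hilbert space of square integrable functions on the circle. -/
abbrev TorusL2 : Type := Lp ℂ 2 torusMeasure

/-! ### Fourier coefficients as inner products in L². -/

section Coefficients

theorem inner_fourierLp (v : TorusL2) (k : ℤ) :
    ⟪(fourierLp 2 k : TorusL2), v⟫_ℂ = fourierCoeff v k := by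
  rw [← fourierBasis_repr, HilbertBasis.repr_apply_apply, coe_fourierBasis]

theorem TorusL2.ext_fourierCoeff {v w : TorusL2} (h : ∀ k, fourierCoeff v k = fourierCoeff w k) :
    v = w := by
  apply fourierBasis.repr.injective
  ext k
  rw [fourierBasis_repr, fourierBasis_repr, h]

/-- Parseval: every term of the coefficient series for the inner product vanishes. This is how
disjointness of frequency supports is used throughout. -/
theorem TorusL2.inner_eq_zero_of_fourierCoeff {v w : TorusL2}
    (h : ∀ k, fourierCoeff v k = 0 ∨ fourierCoeff w k = 0) : ⟪v, w⟫_ℂ = 0 := by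
  rw [← HilbertBasis.tsum_inner_mul_inner fourierBasis v w]
  refine (tsum_congr fun k => ?_).trans tsum_zero
  rw [coe_fourierBasis, inner_fourierLp, ← inner_conj_symm, inner_fourierLp]
  rcases h k with h | h <;> simp [h]

theorem TorusL2.fourierCoeff_sub (v w : TorusL2) (k : ℤ) :
    fourierCoeff (v - w : TorusL2) k = fourierCoeff v k - fourierCoeff w k := by
  simp only [← inner_fourierLp, inner_sub_right]

theorem TorusL2.fourierCoeff_smul (a : ℂ) (v : TorusL2) (k : ℤ) :
    fourierCoeff (a • v : TorusL2) k = a * fourierCoeff v k := by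
  simp only [← inner_fourierLp, inner_smul_right]

theorem TorusL2.fourierCoeff_sum {ι : Type} (s : Finset ι) (v : ι → TorusL2) (k : ℤ) :
    fourierCoeff (∑ i ∈ s, v i : TorusL2) k = ∑ i ∈ s, fourierCoeff (v i) k := by
  simp only [← inner_fourierLp, inner_sum]

theorem fourierCoeff_fourierLp (j k : ℤ) :
    fourierCoeff (fourierLp 2 j : TorusL2) k = if j = k then 1 else 0 := by
  rw [← inner_fourierLp, orthonormal_iff_ite.1 orthonormal_fourier]
  simp [eq_comm]

theorem fourierCoeff_expo (j k : ℤ) : fourierCoeff (expo j) k = if j = k then 1 else 0 := by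
  rw [← fourierCoeff_fourierLp]
  exact congrFun (fourierCoeff_congr_ae (coeFn_fourierLp 2 j).symm) k

theorem fourierCoeff_star (A : Torus → ℂ) (k : ℤ) :
    fourierCoeff (fun ω => star (A ω)) k = star (fourierCoeff A (-k)) := by
  have h := integral_conj (μ := torusMeasure) (f := fun t => fourier (- -k) t • A t)
  rw [fourierCoeff, fourierCoeff, RCLike.star_def, ← h]
  congr 1
  ext t
  simp only [smul_eq_mul, map_mul, ← fourier_neg, neg_neg]

theorem fourierCoeff_expo_mul (A : Torus → ℂ) (j k : ℤ) :
    fourierCoeff (fun ω => expo j ω * A ω) k = fourierCoeff A (k - j) := by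
  rw [fourierCoeff, fourierCoeff]
  congr 1
  ext t
  rw [smul_eq_mul, smul_eq_mul, ← mul_assoc, expo, ← fourier_add]
  congr 3
  ring

theorem norm_expo (j : ℤ) (ω : Torus) : ‖expo j ω‖ = 1 := by
  rw [expo, fourier_apply, Circle.norm_coe]

theorem star_expo (j : ℤ) (ω : Torus) : star (expo j ω) = expo (-j) ω := by
  rw [expo, expo, fourier_neg, RCLike.star_def]

theorem coeFn_fourierLp_expo (j : ℤ) : (fourierLp 2 j : TorusL2) =ᵐ[torusMeasure] expo j :=
  coeFn_fourierLp 2 j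

theorem memLp_expo (j : ℤ) (p : ℝ≥0∞) : MemLp (expo j) p torusMeasure := by
  refine MemLp.of_bound (C := 1) (fourier j).continuous.aestronglyMeasurable ?_
  exact ae_of_all _ fun ω => (norm_expo j ω).le

end Coefficients

/-! ### Unconditional L² sums of functions and of their classes. -/

section L2Sums

/-- The `eLpNorm` of the remainder is the distance in `Lp`, so pointwise-defined series can be
handled in the Hilbert space. -/
theorem l2HasSum_iff_hasSum {ι : Type} {u : ι → Torus → ℂ} {A : Torus → ℂ} {U : ι → TorusL2}
    {V : TorusL2} (hu : ∀ i, u i =ᵐ[torusMeasure] U i) (hA : A =ᵐ[torusMeasure] V) :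
    L2HasSum u A ↔ HasSum U V := by
  have key : ∀ s : Finset ι, eLpNorm (fun ω => A ω - ∑ i ∈ s, u i ω) 2 torusMeasure
      = edist (∑ i ∈ s, U i) V := by
    intro s
    rw [edist_comm, Lp.edist_def]
    apply eLpNorm_congr_ae
    have h : ∀ᵐ ω ∂torusMeasure, ∀ i ∈ s, u i ω = U i ω :=
      (Finset.eventually_all s).2 fun i _ => hu i
    filter_upwards [hA, Lp.coeFn_finsetSum s U, h] with ω h1 h2 h3
    rw [Pi.sub_apply, h1, h2, Finset.sum_apply, Finset.sum_congr rfl h3]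
  unfold L2HasSum
  simp only [key]
  rw [HasSum, SummationFilter.unconditional_filter, tendsto_iff_edist_tendsto_0]
  exact ⟨fun h => h.2.2, fun h => ⟨fun i => (memLp_congr_ae (hu i)).2 (Lp.memLp _),
    (memLp_congr_ae hA).2 (Lp.memLp _), h⟩⟩

theorem ae_eq_smul_fourierLp (a : ℂ) (j : ℤ) :
    (fun ω => a * expo j ω) =ᵐ[torusMeasure] (a • fourierLp 2 j : TorusL2) := by
  filter_upwards [Lp.coeFn_smul a (fourierLp 2 j : TorusL2), coeFn_fourierLp_expo j] with ω h1 h2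
  rw [h1, Pi.smul_apply, h2, smul_eq_mul]

/-- One direction pairs the sum with each exponential; the other is the Fourier series of `V`, whose
terms off the range of `n` vanish. -/
theorem hasSum_smul_fourierLp_iff {ι : Type} {n : ι → ℤ} (hn : Function.Injective n)
    {a : ι → ℂ} {V : TorusL2} :
    HasSum (fun i => a i • (fourierLp 2 (n i) : TorusL2)) V ↔
      (∀ i, fourierCoeff V (n i) = a i) ∧ ∀ k ∉ Set.range n, fourierCoeff V k = 0 := by
  constructor
  · intro h
    have hk : ∀ k, HasSum (fun i => a i * if n i = k then 1 else 0) (fourierCoeff V k) := by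
      intro k
      have := h.mapL (innerSL ℂ (fourierLp 2 k : TorusL2))
      simpa only [innerSL_apply_apply, inner_fourierLp, TorusL2.fourierCoeff_smul,
        fourierCoeff_fourierLp] using this
    constructor
    · intro i
      refine (hk (n i)).unique ?_
      convert hasSum_single i (f := fun i' => a i' * if n i' = n i then 1 else 0) ?_ using 1
      · simp
      · intro i' hi
        simp [hn.ne hi]
    · intro k hkn
      refine (hk k).unique ?_
      convert hasSum_zero (α := ℂ) (β := ι) using 2 with i
      rw [if_neg (fun h => hkn ⟨i, h⟩), mul_zero]
  · rintro ⟨h1, h2⟩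
    have h := hasSum_fourier_series_L2 V
    rw [← hn.hasSum_iff] at h
    · convert h using 2 with i
      simp [h1]
    · intro k hk
      rw [h2 k hk, zero_smul]

theorem l2HasSum_expo_iff {ι : Type} {n : ι → ℤ} (hn : Function.Injective n)
    {a : ι → ℂ} {A : Torus → ℂ} :
    L2HasSum (fun i ω => a i * expo (n i) ω) A ↔ MemLp A 2 torusMeasure ∧
      (∀ i, fourierCoeff A (n i) = a i) ∧ ∀ k ∉ Set.range n, fourierCoeff A k = 0 := by
  constructor
  · intro h
    have hA := h.2.1
    rw [l2HasSum_iff_hasSum (fun i => ae_eq_smul_fourierLp (a i) (n i)) hA.coeFn_toLp.symm,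
      hasSum_smul_fourierLp_iff hn, fourierCoeff_congr_ae hA.coeFn_toLp] at h
    exact ⟨hA, h⟩
  · rintro ⟨hA, h⟩
    rw [l2HasSum_iff_hasSum (fun i => ae_eq_smul_fourierLp (a i) (n i)) hA.coeFn_toLp.symm,
      hasSum_smul_fourierLp_iff hn, fourierCoeff_congr_ae hA.coeFn_toLp]
    exact h

theorem summable_smul_fourierLp {a : ℕ → ℂ} (ha : IsSqSummable a) :
    Summable fun j : ℕ => a j • (fourierLp 2 (j : ℤ) : TorusL2) := by
  have ho : Orthonormal ℂ (fun j : ℕ => (fourierLp 2 (j : ℤ) : TorusL2)) :=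
    orthonormal_fourier.comp _ Nat.cast_injective
  exact (ho.orthogonalFamily.summable_iff_norm_sq_summable a).2 ha

theorem isSqSummable_fourierCoeff (v : TorusL2) :
    IsSqSummable fun j : ℕ => fourierCoeff v (j : ℤ) := by
  have h := (hasSum_sq_fourierCoeff v).summable
  exact h.comp_injective (i := fun j : ℕ => (j : ℤ)) Nat.cast_injective

end L2Sums

/-! ### Bounded multiplication operators. -/

section Multiplication

theorem MeasureTheory.MemLp.bounded_mul {a : Torus → ℂ} (ha : MemLp a ∞ torusMeasure)
    {v : Torus → ℂ} (hv : MemLp v 2 torusMeasure) :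
    MemLp (fun ω => a ω * v ω) 2 torusMeasure := hv.mul ha

/-- Multiplication by an essentially bounded function, as an operator on `L²`. -/
noncomputable def mulL2 (a : Torus → ℂ) (ha : MemLp a ∞ torusMeasure) : TorusL2 →L[ℂ] TorusL2 :=
  LinearMap.mkContinuous
    { toFun := fun v => (ha.bounded_mul (Lp.memLp v)).toLp _
      map_add' := by
        intro v w
        rw [← MemLp.toLp_add, MemLp.toLp_eq_toLp_iff]
        filter_upwards [Lp.coeFn_add v w] with ω h1
        rw [h1, Pi.add_apply, Pi.add_apply, mul_add]
      map_smul' := by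
        intro z v
        rw [RingHom.id_apply, ← MemLp.toLp_const_smul, MemLp.toLp_eq_toLp_iff]
        filter_upwards [Lp.coeFn_smul z v] with ω h1
        rw [h1, Pi.smul_apply, Pi.smul_apply, mul_smul_comm] }
    (eLpNorm a ∞ torusMeasure).toReal (by
      intro v
      apply Lp.norm_le_mul_norm_of_ae_le_mul
      filter_upwards [MemLp.coeFn_toLp (ha.bounded_mul (Lp.memLp v)),
        ae_le_eLpNormEssSup (f := a) (μ := torusMeasure)] with ω h1 h2
      simp only [LinearMap.coe_mk, AddHom.coe_mk]
      rw [h1, norm_mul]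
      gcongr
      rw [← toReal_enorm]
      exact ENNReal.toReal_mono ha.2.ne (by rwa [eLpNorm_exponent_top]))

variable {a : Torus → ℂ} {ha : MemLp a ∞ torusMeasure}

theorem coeFn_mulL2 (a : Torus → ℂ) (ha : MemLp a ∞ torusMeasure) (v : TorusL2) :
    mulL2 a ha v =ᵐ[torusMeasure] fun ω => a ω * v ω :=
  MemLp.coeFn_toLp (ha.bounded_mul (Lp.memLp v))

theorem norm_mulL2_le {C : ℝ} (hC : 0 ≤ C) (h : ∀ᵐ ω ∂torusMeasure, ‖a ω‖ ≤ C) :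
    ‖mulL2 a ha‖ ≤ C := by
  refine ContinuousLinearMap.opNorm_le_bound _ hC fun v => ?_
  apply Lp.norm_le_mul_norm_of_ae_le_mul
  filter_upwards [coeFn_mulL2 a ha v, h] with ω h1 h2
  rw [h1, norm_mul]
  gcongr

theorem inner_mulL2_left {b : Torus → ℂ} {hb : MemLp b ∞ torusMeasure}
    (hab : ∀ᵐ ω ∂torusMeasure, b ω = star (a ω)) (v w : TorusL2) :
    ⟪mulL2 a ha v, w⟫_ℂ = ⟪v, mulL2 b hb w⟫_ℂ := by
  rw [L2.inner_def, L2.inner_def]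
  apply integral_congr_ae
  filter_upwards [coeFn_mulL2 a ha v, coeFn_mulL2 b hb w, hab] with ω h1 h2 h3
  rw [h1, h2, h3]
  simp only [RCLike.inner_apply, map_mul, RCLike.star_def]
  ring

theorem fourierCoeff_mulL2_fourierLp (j k : ℤ) :
    fourierCoeff (mulL2 a ha (fourierLp 2 j)) k = fourierCoeff a (k - j) := by
  rw [← fourierCoeff_expo_mul]
  refine congrFun (fourierCoeff_congr_ae ?_) k
  filter_upwards [coeFn_mulL2 a ha (fourierLp 2 j), coeFn_fourierLp_expo j] with ω h1 h2
  rw [h1, h2, mul_comm]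

end Multiplication

/-! ### The Hardy space, the Riesz projection and one-sided symbols. -/

section Hardy

/-- The Hardy space: square integrable functions without negative frequencies. -/
noncomputable def hardySpace : Submodule ℂ TorusL2 :=
  (Submodule.span ℂ (Set.range fun k : {k : ℤ // k < 0} => (fourierLp 2 (k : ℤ) : TorusL2)))ᗮ

theorem mem_hardySpace {v : TorusL2} :
    v ∈ hardySpace ↔ ∀ k < 0, fourierCoeff v k = 0 := by
  constructor
  · intro h k hk
    rw [← inner_fourierLp]
    exact (Submodule.mem_orthogonal _ _).1 h _ (Submodule.subset_span ⟨⟨k, hk⟩, rfl⟩)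
  · intro h
    rw [hardySpace, Submodule.mem_orthogonal]
    intro u hu
    induction hu using Submodule.span_induction with
    | mem x hx =>
      obtain ⟨⟨k, hk⟩, rfl⟩ := hx
      rw [inner_fourierLp]
      exact h k hk
    | zero => simp
    | add x y _ _ hx hy => rw [inner_add_left, hx, hy, add_zero]
    | smul z x _ hx => rw [inner_smul_left, hx, mul_zero]

instance : hardySpace.HasOrthogonalProjection := by
  unfold hardySpace
  infer_instance

theorem fourierLp_mem_hardySpace {j : ℤ} (hj : 0 ≤ j) : (fourierLp 2 j : TorusL2) ∈ hardySpace :=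
  mem_hardySpace.2 fun k hk => by rw [fourierCoeff_fourierLp, if_neg (by omega)]

/-- The Riesz projection onto the nonnegative frequencies. -/
noncomputable def rieszProj : TorusL2 →L[ℂ] TorusL2 := hardySpace.starProjection

theorem rieszProj_mem (v : TorusL2) : rieszProj v ∈ hardySpace :=
  Submodule.starProjection_apply_mem _ _

theorem rieszProj_eq_self {v : TorusL2} (hv : v ∈ hardySpace) : rieszProj v = v :=
  Submodule.starProjection_eq_self_iff.2 hv

theorem norm_rieszProj_le : ‖rieszProj‖ ≤ 1 := Submodule.starProjection_norm_le _

theorem fourierCoeff_rieszProj (v : TorusL2) (k : ℤ) :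
    fourierCoeff (rieszProj v) k = if 0 ≤ k then fourierCoeff v k else 0 := by
  split_ifs with hk
  · have h := Submodule.starProjection_inner_eq_zero (K := hardySpace) v _
      (fourierLp_mem_hardySpace hk)
    rw [← inner_conj_symm, map_eq_zero, inner_fourierLp, TorusL2.fourierCoeff_sub, sub_eq_zero] at h
    exact h.symm
  · exact mem_hardySpace.1 (rieszProj_mem v) k (by omega)

theorem rieszProj_rieszProj (v : TorusL2) : rieszProj (rieszProj v) = rieszProj v :=
  rieszProj_eq_self (rieszProj_mem v)

variable {a : Torus → ℂ} {ha : MemLp a ∞ torusMeasure}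

/-- Move the symbol to the other side of the pairing with `e_k`, `k < 0`: the conjugate symbol times
`e_k` has only negative frequencies, and `v` has none. -/
theorem mulL2_mem_hardySpace (h : ∀ k < 0, fourierCoeff a k = 0) {v : TorusL2}
    (hv : v ∈ hardySpace) : mulL2 a ha v ∈ hardySpace := by
  have hb : MemLp (fun ω => star (a ω)) ∞ torusMeasure := ha.star
  refine mem_hardySpace.2 fun k hk => ?_
  rw [← inner_fourierLp, ← inner_mulL2_left (ha := hb) (ae_of_all _ fun ω => (star_star _).symm)]
  refine TorusL2.inner_eq_zero_of_fourierCoeff fun j => ?_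
  rw [fourierCoeff_mulL2_fourierLp, fourierCoeff_star]
  rcases lt_or_ge j 0 with hj | hj
  · exact Or.inr (mem_hardySpace.1 hv j hj)
  · left
    rw [h _ (by omega), star_zero]

/-- The mirror image: a symbol without positive frequencies cannot push negative frequencies up to
nonnegative ones. -/
theorem rieszProj_mulL2_eq_zero (h : ∀ k < 0, fourierCoeff a (-k) = 0) {v : TorusL2}
    (hv : rieszProj v = 0) : rieszProj (mulL2 a ha v) = 0 := by
  have hb : MemLp (fun ω => star (a ω)) ∞ torusMeasure := ha.star
  have hv' : ∀ j : ℤ, 0 ≤ j → fourierCoeff v j = 0 := by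
    intro j hj
    have := fourierCoeff_rieszProj v j
    rw [hv, if_pos hj] at this
    rw [← this, ← inner_fourierLp, inner_zero_right]
  apply TorusL2.ext_fourierCoeff
  intro k
  rw [← inner_fourierLp 0, inner_zero_right, fourierCoeff_rieszProj]
  split_ifs with hk
  · rw [← inner_fourierLp, ← inner_mulL2_left (ha := hb) (ae_of_all _ fun ω => (star_star _).symm)]
    refine TorusL2.inner_eq_zero_of_fourierCoeff fun j => ?_
    rw [fourierCoeff_mulL2_fourierLp, fourierCoeff_star]
    rcases lt_or_ge j 0 with hj | hj
    · left
      rw [h _ (by omega), star_zero]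
    · exact Or.inr (hv' j hj)
  · rfl

end Hardy

/-! ### Finite measures are determined by their Fourier coefficients. -/

section MeasureUniqueness

/-- Trigonometric polynomials are uniformly dense in the continuous functions, and integration
against a finite measure is uniformly continuous. -/
theorem Torus.measure_ext_of_integral_fourier {μ ν : Measure Torus} [IsFiniteMeasure μ]
    [IsFiniteMeasure ν] (h : ∀ k : ℤ, ∫ ω, expo k ω ∂μ = ∫ ω, expo k ω ∂ν) : μ = ν := by
  have key : ∀ (ρ : Measure Torus) [IsFiniteMeasure ρ],
      Continuous fun g : C(Torus, ℂ) => ∫ ω, g ω ∂ρ := by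
    intro ρ _
    refine (continuous_integral.comp (ContinuousMap.toLp 1 ρ ℂ).continuous).congr fun g => ?_
    exact integral_congr_ae (ContinuousMap.coeFn_toLp ρ g)
  have hint : ∀ (ρ : Measure Torus) [IsFiniteMeasure ρ] (g : C(Torus, ℂ)), Integrable g ρ :=
    fun ρ _ g => g.continuous.integrable_of_hasCompactSupport (HasCompactSupport.of_compactSpace _)
  have hC : ∀ g : C(Torus, ℂ), ∫ ω, g ω ∂μ = ∫ ω, g ω ∂ν := by
    intro g
    have hg : g ∈ closure (Submodule.span ℂ (Set.range (fourier (T := 2 * Real.pi))) :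
        Set C(Torus, ℂ)) := by
      rw [← Submodule.topologicalClosure_coe, span_fourier_closure_eq_top]
      trivial
    refine closure_minimal (t := {g : C(Torus, ℂ) | ∫ ω, g ω ∂μ = ∫ ω, g ω ∂ν}) ?_
      (isClosed_eq (key μ) (key ν)) hg
    intro p hp
    induction hp using Submodule.span_induction with
    | mem x hx =>
      obtain ⟨k, rfl⟩ := hx
      exact h k
    | zero => simp
    | add x y _ _ hx hy =>
      simp only [Set.mem_ofPred_eq, ContinuousMap.add_apply] at hx hy ⊢
      rw [integral_add (hint μ x) (hint μ y), integral_add (hint ν x) (hint ν y), hx, hy]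
    | smul z x _ hx =>
      simp only [Set.mem_ofPred_eq, ContinuousMap.smul_apply] at hx ⊢
      rw [integral_smul, integral_smul, hx]
  refine ext_of_forall_integral_eq_of_IsFiniteMeasure fun g => ?_
  have := hC ⟨fun ω => (g ω : ℂ), Complex.continuous_ofReal.comp g.continuous⟩
  simp only [ContinuousMap.coe_mk] at this
  rw [integral_complex_ofReal, integral_complex_ofReal] at this
  exact_mod_cast this

/-- `F` is only integrable, so Parseval is unavailable; instead the measures with densities `F` and
its mean are compared. This is applied to f|u|², with u merely in L². -/
theorem ae_eq_const_of_fourierCoeff_eq_zero {F : Torus → ℝ} (hF : Integrable F torusMeasure)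
    (h0 : 0 ≤ᵐ[torusMeasure] F)
    (h : ∀ k : ℤ, k ≠ 0 → fourierCoeff (fun ω => (F ω : ℂ)) k = 0) :
    F =ᵐ[torusMeasure] fun _ => ∫ ω, F ω ∂torusMeasure := by
  set C := ∫ ω, F ω ∂torusMeasure with hCdef
  have hC : 0 ≤ C := integral_nonneg_of_ae h0
  have hdens : ∀ G : Torus → ℝ, Integrable G torusMeasure → 0 ≤ᵐ[torusMeasure] G → ∀ k : ℤ,
      ∫ ω, expo k ω ∂(torusMeasure.withDensity fun ω => ENNReal.ofReal (G ω)) =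
        fourierCoeff (fun ω => (G ω : ℂ)) (-k) := by
    intro G hG hG0 k
    rw [integral_withDensity_eq_integral_toReal_smul₀ hG.1.aemeasurable.ennreal_ofReal
      (ae_of_all _ fun _ => ENNReal.ofReal_lt_top), fourierCoeff]
    apply integral_congr_ae
    filter_upwards [hG0] with ω hω
    rw [ENNReal.toReal_ofReal hω, neg_neg, expo, smul_eq_mul, Complex.real_smul, mul_comm]
  have hfin : ∀ G : Torus → ℝ, Integrable G torusMeasure →
      IsFiniteMeasure (torusMeasure.withDensity fun ω => ENNReal.ofReal (G ω)) :=
    fun G hG => isFiniteMeasure_withDensity_ofReal hG.2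
  have := hfin F hF
  have := hfin (fun _ => C) (integrable_const C)
  have heq : (torusMeasure.withDensity fun ω => ENNReal.ofReal (F ω)) =
      torusMeasure.withDensity fun _ => ENNReal.ofReal C := by
    apply Torus.measure_ext_of_integral_fourier
    intro k
    rw [hdens F hF h0, hdens (fun _ => C) (integrable_const C) (ae_of_all _ fun _ => hC)]
    have hconst : fourierCoeff (fun _ : Torus => (C : ℂ)) (-k) = C * if (0 : ℤ) = -k then 1 else 0 := by
      rw [← fourierCoeff_expo, ← fourierCoeff.const_mul]
      simp [expo]
    rw [hconst]
    by_cases hk : k = 0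
    · subst hk
      simp [fourierCoeff, integral_complex_ofReal, hCdef]
    · rw [h _ (neg_ne_zero.2 hk), if_neg (by omega), mul_zero]
  rw [withDensity_eq_iff_of_sigmaFinite hF.1.aemeasurable.ennreal_ofReal
    aemeasurable_const] at heq
  filter_upwards [heq, h0] with ω h1 h2
  exact (ENNReal.ofReal_eq_ofReal_iff h2 hC).1 h1

end MeasureUniqueness

/-! ### Toeplitz operators and the Wiener–Hopf system. -/

section Toeplitz

variable {f : Torus → ℝ} {m M : ℝ}

theorem memLp_top_of_bounds (hf : AEStronglyMeasurable (fun ω => (f ω : ℂ)) torusMeasure)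
    (hm : 0 < m) (hb : ∀ᵐ ω ∂torusMeasure, m ≤ f ω ∧ f ω ≤ M) :
    MemLp (fun ω => (f ω : ℂ)) ∞ torusMeasure := by
  refine memLp_top_of_bound hf M ?_
  filter_upwards [hb] with ω hω
  rw [Complex.norm_real, Real.norm_of_nonneg (hm.le.trans hω.1)]
  exact hω.2

/-- The Toeplitz operator with a symbol bounded away from zero and infinity is invertible, by a
Neumann series. -/
theorem existsUnique_toeplitz (hfm : MemLp (fun ω => (f ω : ℂ)) ∞ torusMeasure) (hm : 0 < m)
    (hb : ∀ᵐ ω ∂torusMeasure, m ≤ f ω ∧ f ω ≤ M) {w : TorusL2} (hw : w ∈ hardySpace) :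
    ∃! u : TorusL2, u ∈ hardySpace ∧ rieszProj (mulL2 _ hfm u) = w := by
  have hmM : m ≤ M := by
    obtain ⟨ω, h1, h2⟩ := hb.exists
    exact h1.trans h2
  have hM : 0 < M := hm.trans_le hmM
  have hM' : (M : ℂ) ≠ 0 := by exact_mod_cast hM.ne'
  have hq : 0 ≤ 1 - m / M := by
    rw [sub_nonneg, div_le_one hM]
    exact hmM
  have hbound : ∀ᵐ ω ∂torusMeasure, ‖1 - (M : ℂ)⁻¹ * (f ω : ℂ)‖ ≤ 1 - m / M := by
    filter_upwards [hb] with ω hω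
    have h1 : (1 - (M : ℂ)⁻¹ * (f ω : ℂ)) = ((1 - f ω / M : ℝ) : ℂ) := by
      push_cast
      rw [div_eq_inv_mul]
    rw [h1, Complex.norm_real, Real.norm_of_nonneg]
    · gcongr
      exact hω.1
    · rw [sub_nonneg, div_le_one hM]
      exact hω.2
  have ha : MemLp (fun ω => 1 - (M : ℂ)⁻¹ * (f ω : ℂ)) ∞ torusMeasure :=
    memLp_top_of_bound ((aestronglyMeasurable_const).sub (hfm.1.const_mul _)) _ hbound
  have hmul : ∀ v, mulL2 _ ha v = v - (M : ℂ)⁻¹ • mulL2 _ hfm v := by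
    intro v
    apply Lp.ext
    filter_upwards [coeFn_mulL2 _ ha v, coeFn_mulL2 _ hfm v,
      Lp.coeFn_sub v ((M : ℂ)⁻¹ • mulL2 _ hfm v), Lp.coeFn_smul (M : ℂ)⁻¹ (mulL2 _ hfm v)]
      with ω h1 h2 h3 h4
    rw [h1, h3, Pi.sub_apply, h4, Pi.smul_apply, h2, smul_eq_mul]
    ring
  -- On the whole of L², `1 - B` is the identity modulo the Hardy space and M⁻¹Pf on it, so the
  -- Neumann series needs no restriction to a subspace.
  set B : TorusL2 →L[ℂ] TorusL2 := rieszProj * mulL2 _ ha with hB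
  have hBn : ‖B‖ < 1 := by
    calc ‖B‖ ≤ ‖rieszProj‖ * ‖mulL2 _ ha‖ := norm_mul_le _ _
      _ ≤ 1 * (1 - m / M) := mul_le_mul norm_rieszProj_le (norm_mulL2_le hq hbound)
          (norm_nonneg _) zero_le_one
      _ < 1 := by
        have := div_pos hm hM
        linarith
  have hBv : ∀ v, (1 - B) v = v - rieszProj v + (M : ℂ)⁻¹ • rieszProj (mulL2 _ hfm v) := by
    intro v
    rw [sub_apply, hB, one_apply_eq_self,
      mul_apply_eq_comp, hmul, map_sub, map_smul]
    abel
  obtain ⟨T, hT⟩ : IsUnit (1 - B) := ⟨Units.oneSub B hBn, rfl⟩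
  have hTinv : ∀ v, (1 - B) ((↑T⁻¹ : TorusL2 →L[ℂ] TorusL2) v) = v := by
    intro v
    rw [← hT, ← mul_apply_eq_comp, Units.mul_inv, one_apply_eq_self]
  have hinj : ∀ v v', (1 - B) v = (1 - B) v' → v = v' := by
    intro v v' h
    rw [← hT] at h
    have := congrArg (↑T⁻¹ : TorusL2 →L[ℂ] TorusL2) h
    rwa [← mul_apply_eq_comp, ← mul_apply_eq_comp, Units.inv_mul,
      one_apply_eq_self, one_apply_eq_self] at this
  refine ⟨(↑T⁻¹ : TorusL2 →L[ℂ] TorusL2) ((M : ℂ)⁻¹ • w), ?_, ?_⟩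
  · set u := (↑T⁻¹ : TorusL2 →L[ℂ] TorusL2) ((M : ℂ)⁻¹ • w) with hu
    have h1 := hTinv ((M : ℂ)⁻¹ • w)
    rw [← hu, hBv] at h1
    -- Projecting first gives P(fu) = w; substituting this back leaves u = Pu, so u lies in the
    -- Hardy space.
    have h2 := congrArg rieszProj h1
    rw [map_add, map_sub, map_smul, map_smul, rieszProj_rieszProj, rieszProj_rieszProj, sub_self,
      zero_add, rieszProj_eq_self hw] at h2
    have h3 : rieszProj (mulL2 _ hfm u) = w := smul_right_injective _ (inv_ne_zero hM') h2
    refine ⟨?_, h3⟩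
    rw [h3, add_eq_right, sub_eq_zero] at h1
    rw [h1]
    exact rieszProj_mem u
  · rintro v ⟨hv1, hv2⟩
    apply hinj
    rw [hTinv, hBv, rieszProj_eq_self hv1, hv2, sub_self, zero_add]

variable {c : ℤ → ℝ}

theorem hasSum_fourierCoeff_mulL2 (hfm : MemLp (fun ω => (f ω : ℂ)) ∞ torusMeasure)
    (hc : ∀ r, fourierCoeff (fun ω => (f ω : ℂ)) r = c r) {h : ℕ → ℂ} {V : TorusL2}
    (hV : HasSum (fun j : ℕ => h j • (fourierLp 2 (j : ℤ) : TorusL2)) V) (k : ℤ) :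
    HasSum (fun j : ℕ => h j * (c (k - j) : ℂ)) (fourierCoeff (mulL2 _ hfm V) k) := by
  have := (hV.mapL (mulL2 _ hfm)).mapL (innerSL ℂ (fourierLp 2 k : TorusL2))
  simpa only [innerSL_apply_apply, inner_fourierLp, map_smul, TorusL2.fourierCoeff_smul,
    fourierCoeff_mulL2_fourierLp, hc, smul_eq_mul] using this

theorem hasSum_fourierCoeff_of_mem_hardySpace {V : TorusL2} (hV : V ∈ hardySpace) :
    HasSum (fun j : ℕ => fourierCoeff V (j : ℤ) • (fourierLp 2 (j : ℤ) : TorusL2)) V := by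
  rw [hasSum_smul_fourierLp_iff Nat.cast_injective]
  refine ⟨fun _ => rfl, fun k hk => mem_hardySpace.1 hV k ?_⟩
  by_contra hk'
  exact hk ⟨k.toNat, by simp; omega⟩

theorem mem_hardySpace_of_hasSum {h : ℕ → ℂ} {V : TorusL2}
    (hV : HasSum (fun j : ℕ => h j • (fourierLp 2 (j : ℤ) : TorusL2)) V) : V ∈ hardySpace := by
  refine mem_hardySpace.2 fun k hk => ((hasSum_smul_fourierLp_iff Nat.cast_injective).1 hV).2 k ?_
  rintro ⟨j, rfl⟩
  omega

/-- The ℓ-th equation compares the ℓ-th coefficients of fV and G for ℓ ≥ 0; at negative frequencies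
both sides of the projected equation vanish. -/
theorem solvesWienerHopf_iff (hfm : MemLp (fun ω => (f ω : ℂ)) ∞ torusMeasure)
    (hc : ∀ r, fourierCoeff (fun ω => (f ω : ℂ)) r = c r) {g h : ℕ → ℂ} {V G : TorusL2}
    (hV : HasSum (fun j : ℕ => h j • (fourierLp 2 (j : ℤ) : TorusL2)) V)
    (hG : HasSum (fun j : ℕ => g j • (fourierLp 2 (j : ℤ) : TorusL2)) G) :
    SolvesWienerHopf c g h ↔ rieszProj (mulL2 _ hfm V) = G := by
  have hGc := (hasSum_smul_fourierLp_iff Nat.cast_injective).1 hG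
  constructor
  · intro hs
    apply TorusL2.ext_fourierCoeff
    intro k
    rw [fourierCoeff_rieszProj]
    split_ifs with hk
    · lift k to ℕ using hk
      rw [hGc.1]
      exact (hasSum_fourierCoeff_mulL2 hfm hc hV k).unique (hs k)
    · exact (mem_hardySpace.1 (mem_hardySpace_of_hasSum hG) k (by omega)).symm
  · intro hP ℓ
    have := hasSum_fourierCoeff_mulL2 hfm hc hV ℓ
    rwa [show fourierCoeff (mulL2 _ hfm V) (ℓ : ℤ) = g ℓ by
      rw [← hGc.1, ← hP, fourierCoeff_rieszProj, if_pos (Int.natCast_nonneg ℓ)]] at this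

theorem SolvesWienerHopf.unique (hfm : MemLp (fun ω => (f ω : ℂ)) ∞ torusMeasure) (hm : 0 < m)
    (hb : ∀ᵐ ω ∂torusMeasure, m ≤ f ω ∧ f ω ≤ M)
    (hc : ∀ r, fourierCoeff (fun ω => (f ω : ℂ)) r = c r) {g h h' : ℕ → ℂ} (hg : IsSqSummable g)
    (hh : IsSqSummable h) (hh' : IsSqSummable h') (hs : SolvesWienerHopf c g h)
    (hs' : SolvesWienerHopf c g h') : h' = h := by
  obtain ⟨G, hG⟩ := summable_smul_fourierLp hg
  obtain ⟨V, hV⟩ := summable_smul_fourierLp hh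
  obtain ⟨V', hV'⟩ := summable_smul_fourierLp hh'
  have := (existsUnique_toeplitz hfm hm hb (mem_hardySpace_of_hasSum hG)).unique
    ⟨mem_hardySpace_of_hasSum hV, (solvesWienerHopf_iff hfm hc hV hG).1 hs⟩
    ⟨mem_hardySpace_of_hasSum hV', (solvesWienerHopf_iff hfm hc hV' hG).1 hs'⟩
  funext j
  rw [← ((hasSum_smul_fourierLp_iff Nat.cast_injective).1 hV).1,
    ← ((hasSum_smul_fourierLp_iff Nat.cast_injective).1 hV').1, this]

end Toeplitz

/-! ### Coefficients, bounds and uniqueness of spectral factors. -/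

section Factorization

theorem fourierCoeff_one (k : ℤ) :
    fourierCoeff (fun _ : Torus => (1 : ℂ)) k = if (0 : ℤ) = k then 1 else 0 := by
  rw [← fourierCoeff_expo]
  congr 1
  ext ω
  simp [expo]

theorem fourierCoeff_sub_one {A : Torus → ℂ} (hA : MemLp A 2 torusMeasure) (k : ℤ) :
    fourierCoeff (fun ω => A ω - 1) k = fourierCoeff A k - if (0 : ℤ) = k then 1 else 0 := by
  rw [← fourierCoeff_one, ← fourierCoeff_congr_ae hA.coeFn_toLp,
    ← fourierCoeff_congr_ae (memLp_const (1 : ℂ) (p := 2) (μ := torusMeasure)).coeFn_toLp,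
    ← TorusL2.fourierCoeff_sub]
  refine congrFun (fourierCoeff_congr_ae ?_) k
  filter_upwards [Lp.coeFn_sub hA.toLp (memLp_const (1 : ℂ) (p := 2) (μ := torusMeasure)).toLp,
    hA.coeFn_toLp, (memLp_const (1 : ℂ) (p := 2) (μ := torusMeasure)).coeFn_toLp] with ω h1 h2 h3
  rw [h1, Pi.sub_apply, h2, h3]

theorem l2HasSum_expo_pos_iff {a : ℕ → ℂ} {A : Torus → ℂ} :
    L2HasSum (fun (j : ℕ) ω => a j * expo (j + 1) ω) A ↔ MemLp A 2 torusMeasure ∧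
      (∀ j : ℕ, fourierCoeff A (j + 1) = a j) ∧ ∀ k ≤ 0, fourierCoeff A k = 0 := by
  rw [l2HasSum_expo_iff (n := fun j : ℕ => (j : ℤ) + 1) (fun i j h => by simpa using h)]
  refine and_congr_right fun _ => and_congr_right fun _ => forall_congr' fun k => ?_
  have : k ∉ Set.range (fun j : ℕ => (j : ℤ) + 1) ↔ k ≤ 0 := by
    constructor
    · intro h
      by_contra hk
      exact h ⟨(k - 1).toNat, by simp only []; omega⟩
    · rintro h ⟨j, rfl⟩
      simp only [] at h
      omega
  rw [this]

theorem l2HasSum_sub_one_iff {a : ℕ → ℂ} (h0 : a 0 = 1) {A : Torus → ℂ} :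
    L2HasSum (fun (j : ℕ) ω => a (j + 1) * expo (j + 1) ω) (fun ω => A ω - 1) ↔
      MemLp A 2 torusMeasure ∧ (∀ j : ℕ, fourierCoeff A j = a j) ∧
        ∀ k < 0, fourierCoeff A k = 0 := by
  rw [l2HasSum_expo_pos_iff (a := fun j => a (j + 1))]
  have hiff : MemLp (fun ω => A ω - 1) 2 torusMeasure ↔ MemLp A 2 torusMeasure :=
    ⟨fun h => by simpa [Pi.add_def] using h.add (memLp_const (1 : ℂ)),
      fun h => h.sub (memLp_const (1 : ℂ))⟩
  rw [hiff]
  refine and_congr_right fun hA => ?_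
  simp only [fourierCoeff_sub_one hA]
  constructor
  · rintro ⟨h1, h2⟩
    constructor
    · rintro (_ | j)
      · simpa [h0, sub_eq_zero] using h2 0 le_rfl
      · have := h1 j
        rw [if_neg (by omega), sub_zero] at this
        exact_mod_cast this
    · intro k hk
      have := h2 k hk.le
      rwa [if_neg (by omega), sub_zero] at this
  · rintro ⟨h1, h2⟩
    constructor
    · intro j
      rw [if_neg (by omega), sub_zero, ← h1]
      norm_cast
    · intro k hk
      rcases hk.lt_or_eq with hk | rfl
      · rw [h2 k hk, if_neg (by omega), sub_zero]
      · have := h1 0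
        rw [Nat.cast_zero] at this
        rw [this, h0, if_pos rfl, sub_self]

theorem L2HasSum.neg {ι : Type} {u : ι → Torus → ℂ} {A : Torus → ℂ} (h : L2HasSum u A) :
    L2HasSum (fun i ω => -u i ω) (fun ω => -A ω) := by
  refine ⟨fun i => (h.1 i).neg, h.2.1.neg, h.2.2.congr fun s => ?_⟩
  rw [← eLpNorm_neg]
  congr 1
  ext ω
  simp only [Pi.neg_apply, Finset.sum_neg_distrib]
  ring

theorem l2HasSum_one_sub_iff {a : ℕ → ℂ} (h0 : a 0 = -1) {A : Torus → ℂ} :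
    L2HasSum (fun (j : ℕ) ω => a (j + 1) * expo (j + 1) ω) (fun ω => 1 - A ω) ↔
      MemLp A 2 torusMeasure ∧ (∀ j : ℕ, fourierCoeff A j = -a j) ∧
        ∀ k < 0, fourierCoeff A k = 0 := by
  rw [← l2HasSum_sub_one_iff (a := fun j => -a j) (by rw [h0, neg_neg])]
  constructor <;> intro h <;> simpa using h.neg

namespace IsSpectralFactorization

variable {f : Torus → ℝ} {σsq : ℝ} {ψ φ : ℕ → ℝ} {Ψ Φ : Torus → ℂ} {m M : ℝ}

theorem psi_coeff (h : IsSpectralFactorization f σsq ψ φ Ψ Φ) :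
    MemLp Ψ 2 torusMeasure ∧ (∀ j : ℕ, fourierCoeff Ψ j = ψ j) ∧ ∀ k < 0, fourierCoeff Ψ k = 0 :=
  (l2HasSum_sub_one_iff (a := fun j => (ψ j : ℂ)) (by simp [h.psi_zero])).1 h.psi_sum

theorem phi_coeff (h : IsSpectralFactorization f σsq ψ φ Ψ Φ) :
    MemLp Φ 2 torusMeasure ∧ (∀ j : ℕ, fourierCoeff Φ j = -φ j) ∧ ∀ k < 0, fourierCoeff Φ k = 0 :=
  (l2HasSum_one_sub_iff (a := fun j => (φ j : ℂ)) (by simp [h.phi_zero])).1 h.phi_sum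

theorem mul_phi (h : IsSpectralFactorization f σsq ψ φ Ψ Φ) :
    ∀ᵐ ω ∂torusMeasure, (f ω : ℂ) * Φ ω = σsq * star (Ψ ω) := by
  filter_upwards [h.eq_psi, h.phi_eq_inv] with ω h1 h2
  rw [h1]
  push_cast
  rw [← Complex.mul_conj', RCLike.star_def]
  linear_combination (σsq : ℂ) * conj (Ψ ω) * h2

theorem memLp_top_psi (h : IsSpectralFactorization f σsq ψ φ Ψ Φ)
    (hb : ∀ᵐ ω ∂torusMeasure, m ≤ f ω ∧ f ω ≤ M) : MemLp Ψ ∞ torusMeasure := by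
  -- The bound comes from |Ψ|² = f/σ² ≤ M/σ².
  refine memLp_top_of_bound h.psi_coeff.1.1 √(M / σsq) ?_
  filter_upwards [h.eq_psi, hb] with ω h1 h2
  apply Real.le_sqrt_of_sq_le
  rw [le_div_iff₀' h.sigma_pos, ← h1]
  exact h2.2

theorem memLp_top_phi (h : IsSpectralFactorization f σsq ψ φ Ψ Φ) (hm : 0 < m)
    (hb : ∀ᵐ ω ∂torusMeasure, m ≤ f ω ∧ f ω ≤ M) : MemLp Φ ∞ torusMeasure := by
  -- The bound comes from |Φ|² = σ²/f ≤ σ²/m.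
  refine memLp_top_of_bound h.phi_coeff.1.1 √(σsq / m) ?_
  filter_upwards [h.eq_phi, h.phi_eq_inv, hb] with ω h1 h2 h3
  apply Real.le_sqrt_of_sq_le
  have hΦ : 0 < ‖Φ ω‖ ^ 2 := by
    have : Φ ω ≠ 0 := left_ne_zero_of_mul (h2 ▸ one_ne_zero)
    positivity
  rw [le_div_iff₀ hm]
  have := h3.1
  rwa [h1, ← div_eq_mul_inv, le_div_iff₀' hΦ] at this

/-- `Φ / σ²` is the solution of the Toeplitz equation with right-hand side `1`. -/
theorem toeplitz_phi (h : IsSpectralFactorization f σsq ψ φ Ψ Φ)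
    (hfm : MemLp (fun ω => (f ω : ℂ)) ∞ torusMeasure) :
    (σsq : ℂ)⁻¹ • h.phi_coeff.1.toLp ∈ hardySpace ∧
      rieszProj (mulL2 _ hfm ((σsq : ℂ)⁻¹ • h.phi_coeff.1.toLp)) = fourierLp 2 0 := by
  have hσ : (σsq : ℂ) ≠ 0 := by exact_mod_cast h.sigma_pos.ne'
  constructor
  · refine Submodule.smul_mem _ _ (mem_hardySpace.2 fun k hk => ?_)
    rw [fourierCoeff_congr_ae h.phi_coeff.1.coeFn_toLp, h.phi_coeff.2.2 k hk]
  · have hfu : mulL2 _ hfm ((σsq : ℂ)⁻¹ • h.phi_coeff.1.toLp) =ᵐ[torusMeasure]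
        fun ω => star (Ψ ω) := by
      filter_upwards [coeFn_mulL2 _ hfm ((σsq : ℂ)⁻¹ • h.phi_coeff.1.toLp), h.mul_phi,
        Lp.coeFn_smul (σsq : ℂ)⁻¹ h.phi_coeff.1.toLp, h.phi_coeff.1.coeFn_toLp]
        with ω h1 h2 h3 h4
      rw [h1, h3, Pi.smul_apply, h4, smul_eq_mul, mul_left_comm, h2, inv_mul_cancel_left₀ hσ]
    apply TorusL2.ext_fourierCoeff
    intro k
    rw [fourierCoeff_rieszProj, fourierCoeff_congr_ae hfu, fourierCoeff_star,
      fourierCoeff_fourierLp]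
    rcases lt_trichotomy k 0 with hk | rfl | hk
    · rw [if_neg (by omega), if_neg (by omega)]
    · have := h.psi_coeff.2.1 0
      rw [Nat.cast_zero, h.psi_zero] at this
      simp [this]
    · rw [h.psi_coeff.2.2 _ (by omega), if_neg hk.ne, star_zero, ite_self]

/-- Both Φ/σ² solve P(fu) = 1. The zeroth coefficient of the solution is 1/σ², which fixes σ², then
Φ, then Ψ = Φ⁻¹. -/
theorem unique (h : IsSpectralFactorization f σsq ψ φ Ψ Φ)
    (hfm : MemLp (fun ω => (f ω : ℂ)) ∞ torusMeasure) (hm : 0 < m)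
    (hb : ∀ᵐ ω ∂torusMeasure, m ≤ f ω ∧ f ω ≤ M)
    {σsq' : ℝ} {ψ' φ' : ℕ → ℝ} {Ψ' Φ' : Torus → ℂ}
    (h' : IsSpectralFactorization f σsq' ψ' φ' Ψ' Φ') : σsq' = σsq ∧ ψ' = ψ ∧ φ' = φ := by
  have hu := (existsUnique_toeplitz hfm hm hb (fourierLp_mem_hardySpace le_rfl)).unique
    (h'.toeplitz_phi hfm) (h.toeplitz_phi hfm)
  have hcoef : ∀ n : ℕ, (σsq' : ℂ)⁻¹ * -φ' n = (σsq : ℂ)⁻¹ * -φ n := by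
    intro n
    have := congrArg (fun v : TorusL2 => fourierCoeff v (n : ℤ)) hu
    simp only [TorusL2.fourierCoeff_smul] at this
    rwa [fourierCoeff_congr_ae h.phi_coeff.1.coeFn_toLp,
      fourierCoeff_congr_ae h'.phi_coeff.1.coeFn_toLp, h.phi_coeff.2.1, h'.phi_coeff.2.1] at this
  have hσ : σsq' = σsq := by
    have := hcoef 0
    rw [h.phi_zero, h'.phi_zero] at this
    simpa using this
  subst hσ
  have hσ0 : (σsq' : ℂ)⁻¹ ≠ 0 := inv_ne_zero (by exact_mod_cast h.sigma_pos.ne')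
  refine ⟨rfl, ?_, ?_⟩
  · have hΦ : Φ' =ᵐ[torusMeasure] Φ :=
      (MemLp.toLp_eq_toLp_iff _ _).1 (smul_right_injective _ hσ0 hu)
    have hΨ : Ψ' =ᵐ[torusMeasure] Ψ := by
      filter_upwards [hΦ, h.phi_eq_inv, h'.phi_eq_inv] with ω h1 h2 h3
      rw [h1] at h3
      exact mul_left_cancel₀ (left_ne_zero_of_mul (h2 ▸ one_ne_zero)) (h3.trans h2.symm)
    funext n
    have h1 := h'.psi_coeff.2.1 n
    rw [fourierCoeff_congr_ae hΨ, h.psi_coeff.2.1] at h1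
    exact_mod_cast h1.symm
  · funext n
    have := mul_left_cancel₀ hσ0 (hcoef n)
    exact_mod_cast neg_injective this

end IsSpectralFactorization

end Factorization

/-! ### Existence of the factorization from P(fu) = 1. -/

section Existence

variable {f : Torus → ℝ} {m M : ℝ} {c : ℤ → ℝ}

theorem HasSum.im_eq_zero_of_real {ι : Type} {a b : ι → ℂ} {A : ℂ} (h : HasSum (fun i => a i * b i) A)
    (ha : ∀ i, (a i).im = 0) (hb : ∀ i, (b i).im = 0) : A.im = 0 := by
  have := Complex.hasSum_im h
  simp only [Complex.mul_im, ha, hb, mul_zero, zero_mul, add_zero] at this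
  exact this.unique hasSum_zero

theorem fourierCoeff_mul_norm_sq_eq_inner (hfm : MemLp (fun ω => (f ω : ℂ)) ∞ torusMeasure) (u : TorusL2) (k : ℤ) :
    fourierCoeff (fun ω => ((f ω * ‖u ω‖ ^ 2 : ℝ) : ℂ)) k =
      ⟪mulL2 _ (memLp_expo k ∞) u, mulL2 _ hfm u⟫_ℂ := by
  rw [L2.inner_def, fourierCoeff]
  apply integral_congr_ae
  filter_upwards [coeFn_mulL2 _ (memLp_expo k ∞) u, coeFn_mulL2 _ hfm u] with ω h1 h2
  rw [h1, h2, RCLike.inner_apply, map_mul, ← RCLike.star_def, star_expo, expo, smul_eq_mul]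
  push_cast
  rw [← Complex.mul_conj', RCLike.star_def]
  ring

/-- For a solution `u` of the Toeplitz equation with right-hand side `1`, the function `f |u|²` is
a positive constant, namely the zeroth Fourier coefficient of `u`. -/
theorem toeplitz_mul_norm_sq (hfm : MemLp (fun ω => (f ω : ℂ)) ∞ torusMeasure) (hm : 0 < m)
    (hb : ∀ᵐ ω ∂torusMeasure, m ≤ f ω ∧ f ω ≤ M) {u : TorusL2} (hu : u ∈ hardySpace)
    (hfu : rieszProj (mulL2 _ hfm u) = fourierLp 2 0) :
    ∃ C : ℝ, 0 < C ∧ fourierCoeff u 0 = C ∧ ∀ᵐ ω ∂torusMeasure, f ω * ‖u ω‖ ^ 2 = C := by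
  have hfuc : ∀ j : ℤ, 0 ≤ j → fourierCoeff (mulL2 _ hfm u) j = if (0 : ℤ) = j then 1 else 0 := by
    intro j hj
    rw [← fourierCoeff_fourierLp, ← hfu, fourierCoeff_rieszProj, if_pos hj]
  have hpos : ∀ k : ℤ, 0 < k → fourierCoeff (fun ω => ((f ω * ‖u ω‖ ^ 2 : ℝ) : ℂ)) k = 0 := by
    intro k hk
    rw [fourierCoeff_mul_norm_sq_eq_inner hfm]
    refine TorusL2.inner_eq_zero_of_fourierCoeff fun j => ?_
    rcases le_or_gt j 0 with hj | hj
    · left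
      rw [fourierCoeff_congr_ae (coeFn_mulL2 _ (memLp_expo k ∞) u), fourierCoeff_expo_mul]
      exact mem_hardySpace.1 hu _ (by omega)
    · right
      rw [hfuc j hj.le, if_neg hj.ne]
  have hne : ∀ k : ℤ, k ≠ 0 → fourierCoeff (fun ω => ((f ω * ‖u ω‖ ^ 2 : ℝ) : ℂ)) k = 0 := by
    intro k hk
    rcases hk.lt_or_gt with hk | hk
    -- Negative frequencies follow from positive ones because f|u|² is real.
    · have h := fourierCoeff_star (fun ω => ((f ω * ‖u ω‖ ^ 2 : ℝ) : ℂ)) k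
      rw [hpos (-k) (by omega), star_zero] at h
      simpa only [RCLike.star_def, Complex.conj_ofReal] using h
    · exact hpos k hk
  have hint : Integrable (fun ω => f ω * ‖u ω‖ ^ 2) torusMeasure := by
    have h := (L2.integrable_inner (𝕜 := ℂ) u (mulL2 _ hfm u)).re
    refine h.congr ?_
    filter_upwards [coeFn_mulL2 _ hfm u] with ω h1
    rw [h1, RCLike.inner_apply, mul_assoc, Complex.mul_conj', ← Complex.ofReal_pow,
      ← Complex.ofReal_mul]
    exact Complex.ofReal_re _
  have h0 : 0 ≤ᵐ[torusMeasure] fun ω => f ω * ‖u ω‖ ^ 2 := by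
    filter_upwards [hb] with ω hω
    exact mul_nonneg (hm.le.trans hω.1) (sq_nonneg _)
  have hconst := ae_eq_const_of_fourierCoeff_eq_zero hint h0 hne
  set C := ∫ ω, f ω * ‖u ω‖ ^ 2 ∂torusMeasure with hC
  refine ⟨C, ?_, ?_, hconst⟩
  · refine (integral_nonneg_of_ae h0).lt_of_ne' fun hC0 => ?_
    have hu0 : u = 0 := by
      rw [Lp.eq_zero_iff_ae_eq_zero]
      filter_upwards [hconst, hb] with ω h1 h2
      rw [hC, hC0] at h1
      have h3 : f ω ≠ 0 := (hm.trans_le h2.1).ne'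
      simpa [h3] using h1
    have h1 := hfuc 0 le_rfl
    rw [hu0, map_zero, ← inner_fourierLp, inner_zero_right, if_pos rfl] at h1
    exact zero_ne_one h1
  · have h1 : fourierCoeff (fun ω => ((f ω * ‖u ω‖ ^ 2 : ℝ) : ℂ)) 0 = C := by
      simp only [fourierCoeff, neg_zero, fourier_zero, one_smul]
      rw [integral_complex_ofReal]
    have h2 : mulL2 _ (memLp_expo 0 ∞) u = u := by
      apply Lp.ext
      filter_upwards [coeFn_mulL2 _ (memLp_expo 0 ∞) u] with ω hω
      rw [hω, expo, fourier_zero, one_mul]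
    rw [fourierCoeff_mul_norm_sq_eq_inner hfm, h2] at h1
    -- fu - 1 has only negative frequencies, hence is orthogonal to u. So C = ⟨u, fu⟩ = ⟨u, 1⟩, the
    -- conjugate of the zeroth coefficient of u.
    have h3 : ⟪u, mulL2 _ hfm u - fourierLp 2 0⟫_ℂ = 0 := by
      refine TorusL2.inner_eq_zero_of_fourierCoeff fun j => ?_
      rcases lt_or_ge j 0 with hj | hj
      · exact Or.inl (mem_hardySpace.1 hu j hj)
      · right
        rw [TorusL2.fourierCoeff_sub, hfuc j hj, fourierCoeff_fourierLp, sub_self]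
    rw [inner_sub_right, h1, sub_eq_zero, ← inner_conj_symm, inner_fourierLp] at h3
    rw [← Complex.conj_conj (fourierCoeff u 0), ← h3, Complex.conj_ofReal]

theorem isSqSummable_single : IsSqSummable fun j : ℕ => if j = 0 then 1 else 0 :=
  summable_of_ne_finset_zero (s := {0}) fun j hj => by
    have : j ≠ 0 := by simpa using hj
    simp [this]

/-- The solution of the Toeplitz equation with right-hand side `1` has real coefficients. -/
theorem toeplitz_coeff_im (hfm : MemLp (fun ω => (f ω : ℂ)) ∞ torusMeasure) (hm : 0 < m)
    (hb : ∀ᵐ ω ∂torusMeasure, m ≤ f ω ∧ f ω ≤ M)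
    (hc : ∀ r, fourierCoeff (fun ω => (f ω : ℂ)) r = c r) {u : TorusL2} (hu : u ∈ hardySpace)
    (hfu : rieszProj (mulL2 _ hfm u) = fourierLp 2 0) (j : ℕ) :
    (fourierCoeff u (j : ℤ)).im = 0 := by
  have hG : HasSum (fun j : ℕ => (if j = 0 then (1 : ℂ) else 0) • (fourierLp 2 (j : ℤ) : TorusL2))
      (fourierLp 2 0) := by
    convert hasSum_ite_eq (0 : ℕ) (fourierLp 2 0 : TorusL2) using 2 with j
    split_ifs with h
    · rw [h, one_smul, Nat.cast_zero]
    · rw [zero_smul]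
  have hs := (solvesWienerHopf_iff hfm hc (hasSum_fourierCoeff_of_mem_hardySpace hu) hG).2 hfu
  -- Since `c` and the right-hand side are real, the conjugate sequence is also a solution;
  -- uniqueness makes it equal to the original.
  have hs' : SolvesWienerHopf c (fun j : ℕ => if j = 0 then (1 : ℂ) else 0)
      fun j : ℕ => conj (fourierCoeff u (j : ℤ)) := by
    intro ℓ
    have := (hs ℓ).map (starRingEnd ℂ) Complex.continuous_conj
    simpa [Function.comp_def, apply_ite] using this
  have hsq := isSqSummable_fourierCoeff u
  have hsq' : IsSqSummable fun j : ℕ => conj (fourierCoeff u (j : ℤ)) := by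
    simpa only [IsSqSummable, RCLike.norm_conj] using hsq
  have := congrFun (hs.unique hfm hm hb hc isSqSummable_single hsq hsq' hs') j
  exact Complex.conj_eq_iff_im.1 this

/-- With P(fu) = 1 and f|u|² = C, the choice Φ = u/C, Ψ = (fu)* gives ΦΨ = f|u|²/C = 1. Conjugating
fu, whose nonnegative part is 1, makes Ψ one-sided with constant term 1. -/
theorem exists_isSpectralFactorization (hfm : MemLp (fun ω => (f ω : ℂ)) ∞ torusMeasure)
    (hm : 0 < m) (hb : ∀ᵐ ω ∂torusMeasure, m ≤ f ω ∧ f ω ≤ M)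
    (hc : ∀ r, fourierCoeff (fun ω => (f ω : ℂ)) r = c r) :
    ∃ (σsq : ℝ) (ψ φ : ℕ → ℝ) (Ψ Φ : Torus → ℂ), IsSpectralFactorization f σsq ψ φ Ψ Φ := by
  obtain ⟨u, ⟨hu, hfu⟩, -⟩ := existsUnique_toeplitz hfm hm hb (fourierLp_mem_hardySpace le_rfl)
  obtain ⟨C, hC, huC, hconst⟩ := toeplitz_mul_norm_sq hfm hm hb hu hfu
  have hC' : (C : ℂ) ≠ 0 := by exact_mod_cast hC.ne'
  have hfuc : ∀ j : ℤ, 0 ≤ j → fourierCoeff (mulL2 _ hfm u) j = if (0 : ℤ) = j then 1 else 0 := by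
    intro j hj
    rw [← fourierCoeff_fourierLp, ← hfu, fourierCoeff_rieszProj, if_pos hj]
  have hure := toeplitz_coeff_im hfm hm hb hc hu hfu
  have hfure : ∀ k, (fourierCoeff (mulL2 _ hfm u) k).im = 0 := fun k =>
    (hasSum_fourierCoeff_mulL2 hfm hc (hasSum_fourierCoeff_of_mem_hardySpace hu) k).im_eq_zero_of_real
      hure fun j => Complex.ofReal_im _
  have hne : ∀ᵐ ω ∂torusMeasure, f ω ≠ 0 ∧ u ω ≠ 0 := by
    filter_upwards [hb, hconst] with ω h1 h2
    refine ⟨(hm.trans_le h1.1).ne', fun h => hC.ne ?_⟩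
    rw [← h2, h, norm_zero]
    ring
  have hψ0 : fourierCoeff (mulL2 _ hfm u) (-((0 : ℕ) : ℤ)) = 1 := by
    rw [Nat.cast_zero, neg_zero, hfuc 0 le_rfl, if_pos rfl]
  refine ⟨C⁻¹, fun j => (fourierCoeff (mulL2 _ hfm u) (-j)).re,
    fun j => -(C⁻¹ * (fourierCoeff u (j : ℤ)).re), fun ω => star (mulL2 _ hfm u ω),
    fun ω => (C : ℂ)⁻¹ * u ω, inv_pos.2 hC, ?_, ?_, ?_, ?_, ?_, ?_, ?_⟩
  · simp only [hψ0, Complex.one_re]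
  · rw [Nat.cast_zero, huC, Complex.ofReal_re, inv_mul_cancel₀ hC.ne']
  · refine (l2HasSum_sub_one_iff
      (a := fun j : ℕ => ((fourierCoeff (mulL2 _ hfm u) (-j)).re : ℂ)) ?_).2 ⟨?_, ?_, ?_⟩
    · simp only [hψ0, Complex.one_re, Complex.ofReal_one]
    · exact (Lp.memLp _).star
    · intro j
      have := Complex.conj_eq_iff_im.2 (hfure (-j))
      rw [fourierCoeff_star, RCLike.star_def, this]
      exact (Complex.conj_eq_iff_re.1 this).symm
    · intro k hk
      rw [fourierCoeff_star, hfuc _ (by omega), if_neg (by omega), star_zero]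
  · refine (l2HasSum_one_sub_iff
      (a := fun j : ℕ => ((-(C⁻¹ * (fourierCoeff u (j : ℤ)).re) : ℝ) : ℂ)) ?_).2 ⟨?_, ?_, ?_⟩
    · rw [Nat.cast_zero, huC, Complex.ofReal_re, inv_mul_cancel₀ hC.ne']
      norm_num
    · exact (Lp.memLp u).const_mul _
    · intro j
      rw [fourierCoeff.const_mul]
      push_cast
      rw [neg_neg, Complex.conj_eq_iff_re.1 (Complex.conj_eq_iff_im.2 (hure j))]
    · intro k hk
      rw [fourierCoeff.const_mul, mem_hardySpace.1 hu k hk, mul_zero]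
  · filter_upwards [coeFn_mulL2 _ hfm u, hconst] with ω h1 h2
    rw [h1, RCLike.star_def, map_mul, Complex.conj_ofReal]
    have h3 : (f ω : ℂ) * (u ω * conj (u ω)) = C := by
      rw [Complex.mul_conj', ← h2]
      push_cast
      rfl
    field_simp
    linear_combination h3
  · filter_upwards [coeFn_mulL2 _ hfm u, hconst] with ω h1 h2
    rw [h1, norm_star, norm_mul, mul_pow, Complex.norm_real, Real.norm_eq_abs, sq_abs]
    field_simp
    rw [← h2]
    ring
  · filter_upwards [hconst, hne] with ω h2 h3
    have h4 := norm_ne_zero_iff.2 h3.2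
    rw [norm_mul, norm_inv, Complex.norm_real, Real.norm_of_nonneg hC.le]
    field_simp
    exact h2

end Existence

/-! ### Explicit solution and its series expansions. -/

section Solution

variable {f : Torus → ℝ} {m M : ℝ} {c : ℤ → ℝ} {σsq : ℝ} {ψ φ : ℕ → ℝ} {Ψ Φ : Torus → ℂ}

theorem fourierCoeff_mulL2_star_fourierLp {A : Torus → ℂ}
    (hA : MemLp (fun ω => star (A ω)) ∞ torusMeasure) (ℓ k : ℤ) :
    fourierCoeff (mulL2 _ hA (fourierLp 2 ℓ)) k = star (fourierCoeff A (ℓ - k)) := by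
  rw [fourierCoeff_mulL2_fourierLp, fourierCoeff_star, neg_sub]

namespace IsSpectralFactorization

/-- Φ*e_ℓ has frequencies ℓ - s with s ≥ 0, and P keeps only s ≤ ℓ, so the sum is finite. The term s
= 0 is `e_ℓ` itself, since `φ 0 = -1`. -/
theorem rieszProj_mulL2_star_phi (h : IsSpectralFactorization f σsq ψ φ Ψ Φ)
    (hΦ : MemLp (fun ω => star (Φ ω)) ∞ torusMeasure) (ℓ : ℕ) :
    rieszProj (mulL2 _ hΦ (fourierLp 2 (ℓ : ℤ))) =
      fourierLp 2 (ℓ : ℤ) - ∑ s ∈ Finset.Icc 1 ℓ, (φ s : ℂ) • fourierLp 2 ((ℓ : ℤ) - (s : ℤ)) := by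
  apply TorusL2.ext_fourierCoeff
  intro k
  simp only [fourierCoeff_rieszProj, fourierCoeff_mulL2_star_fourierLp, TorusL2.fourierCoeff_sub,
    TorusL2.fourierCoeff_sum, TorusL2.fourierCoeff_smul, fourierCoeff_fourierLp]
  rcases lt_trichotomy k ℓ with hk | rfl | hk
  · rw [if_neg hk.ne', zero_sub]
    obtain ⟨n, hn⟩ := Int.eq_ofNat_of_zero_le (sub_nonneg.2 hk.le)
    rw [hn, h.phi_coeff.2.1]
    split_ifs with h0
    · rw [Finset.sum_eq_single n]
      · rw [if_pos (by omega), mul_one, star_neg, RCLike.star_def, Complex.conj_ofReal]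
      · intro s _ hs
        rw [if_neg (by omega), mul_zero]
      · intro hn'
        rw [Finset.mem_Icc] at hn'
        omega
    · rw [Finset.sum_eq_zero, neg_zero]
      intro s hs
      rw [Finset.mem_Icc] at hs
      rw [if_neg (by omega), mul_zero]
  · have h0 := h.phi_coeff.2.1 0
    rw [Nat.cast_zero, h.phi_zero] at h0
    rw [sub_self, h0, if_pos (Int.natCast_nonneg ℓ), if_pos rfl, Finset.sum_eq_zero]
    · simp
    · intro s hs
      rw [Finset.mem_Icc] at hs
      rw [if_neg (by omega), mul_zero]
  · rw [h.phi_coeff.2.2 _ (by omega), star_zero, ite_self, if_neg hk.ne, Finset.sum_eq_zero,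
      sub_zero]
    intro s hs
    rw [if_neg (by omega), mul_zero]

/-- The tails `φ_ℓ` are the conjugates of the negative frequency parts of `-e^{iℓω} Φ*`. -/
theorem isARTail (h : IsSpectralFactorization f σsq ψ φ Ψ Φ)
    (hΦ : MemLp (fun ω => star (Φ ω)) ∞ torusMeasure) :
    IsARTail φ fun ℓ ω => star ((rieszProj (mulL2 _ hΦ (fourierLp 2 (ℓ : ℤ))) -
      mulL2 _ hΦ (fourierLp 2 (ℓ : ℤ)) : TorusL2) ω) := by
  intro ℓ
  refine (l2HasSum_expo_pos_iff (a := fun s => (φ (ℓ + (s + 1)) : ℂ))).2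
    ⟨(Lp.memLp _).star, fun s => ?_, fun k hk => ?_⟩
  · rw [fourierCoeff_star, TorusL2.fourierCoeff_sub, fourierCoeff_rieszProj, if_neg (by omega),
      zero_sub, fourierCoeff_mulL2_star_fourierLp, ← star_neg, star_star,
      show (ℓ : ℤ) - -((s : ℤ) + 1) = ((ℓ + (s + 1) : ℕ) : ℤ) by push_cast; ring,
      h.phi_coeff.2.1, neg_neg]
  · rw [fourierCoeff_star, TorusL2.fourierCoeff_sub, fourierCoeff_rieszProj, if_pos (by omega),
      sub_self, star_zero]

/-- The Wiener–Hopf technique: `H = σ⁻² Φ P(Φ* G)` solves `P(f H) = G`. -/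
theorem toeplitz_solution (h : IsSpectralFactorization f σsq ψ φ Ψ Φ)
    (hfm : MemLp (fun ω => (f ω : ℂ)) ∞ torusMeasure) (hΦ : MemLp Φ ∞ torusMeasure)
    (hΨs : MemLp (fun ω => star (Ψ ω)) ∞ torusMeasure)
    (hΦs : MemLp (fun ω => star (Φ ω)) ∞ torusMeasure) {G : TorusL2} (hG : G ∈ hardySpace) :
    (σsq : ℂ)⁻¹ • mulL2 _ hΦ (rieszProj (mulL2 _ hΦs G)) ∈ hardySpace ∧
      mulL2 _ hfm ((σsq : ℂ)⁻¹ • mulL2 _ hΦ (rieszProj (mulL2 _ hΦs G))) =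
        mulL2 _ hΨs (rieszProj (mulL2 _ hΦs G)) ∧
      rieszProj (mulL2 _ hΨs (rieszProj (mulL2 _ hΦs G))) = G := by
  have hσ : (σsq : ℂ) ≠ 0 := by exact_mod_cast h.sigma_pos.ne'
  refine ⟨Submodule.smul_mem _ _ (mulL2_mem_hardySpace h.phi_coeff.2.2 (rieszProj_mem _)), ?_, ?_⟩
  · set N := rieszProj (mulL2 _ hΦs G)
    apply Lp.ext
    rw [map_smul]
    filter_upwards [Lp.coeFn_smul (σsq : ℂ)⁻¹ (mulL2 _ hfm (mulL2 _ hΦ N)),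
      coeFn_mulL2 _ hfm (mulL2 _ hΦ N), coeFn_mulL2 _ hΦ N, coeFn_mulL2 _ hΨs N, h.mul_phi]
      with ω h1 h2 h3 h4 h5
    rw [h1, Pi.smul_apply, h2, h3, h4, smul_eq_mul, ← mul_assoc (f ω : ℂ), h5, mul_assoc,
      inv_mul_cancel_left₀ hσ]
  -- Ψ* has no positive frequencies, so the part of Φ*G removed by the inner projection does not
  -- contribute after the outer one.
  · have h1 : rieszProj (mulL2 _ hΨs (mulL2 _ hΦs G - rieszProj (mulL2 _ hΦs G))) = 0 := by
      apply rieszProj_mulL2_eq_zero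
      · intro k hk
        rw [fourierCoeff_star, neg_neg, h.psi_coeff.2.2 k hk, star_zero]
      · rw [map_sub, rieszProj_rieszProj, sub_self]
    have h2 : mulL2 _ hΨs (mulL2 _ hΦs G) = G := by
      apply Lp.ext
      filter_upwards [coeFn_mulL2 _ hΨs (mulL2 _ hΦs G), coeFn_mulL2 _ hΦs G, h.phi_eq_inv]
        with ω h1 h2 h3
      rw [h1, h2, ← mul_assoc, ← star_mul, h3, star_one, one_mul]
    rw [map_sub, map_sub, h2, rieszProj_eq_self hG, sub_eq_zero] at h1
    exact h1.symm

end IsSpectralFactorization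

/-- A bounded operator passes through the unconditional Fourier series of `G`, so only its values on
exponentials have to be identified. -/
theorem l2HasSum_of_continuousLinearMap (T : TorusL2 →L[ℂ] TorusL2) {g : ℕ → ℂ} {G : TorusL2}
    (hG : HasSum (fun j : ℕ => g j • (fourierLp 2 (j : ℤ) : TorusL2)) G) {u : ℕ → Torus → ℂ}
    (hu : ∀ ℓ : ℕ, u ℓ =ᵐ[torusMeasure] T (fourierLp 2 (ℓ : ℤ))) :
    L2HasSum (fun ℓ ω => g ℓ * u ℓ ω) (T G) := by
  refine (l2HasSum_iff_hasSum (fun ℓ => ?_) EventuallyEq.rfl).2 (hG.mapL T)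
  rw [map_smul]
  filter_upwards [hu ℓ, Lp.coeFn_smul (g ℓ) (T (fourierLp 2 (ℓ : ℤ)))] with ω h1 h2
  rw [h1, h2, Pi.smul_apply, smul_eq_mul]

end Solution

/-! ### The main theorem. -/

theorem theorem2 (c : ℤ → ℝ) (hsymm : ∀ r, c (-r) = c r) (hpd : IsPositiveDefiniteSeq c)
    (f : Torus → ℝ)
    (hf : L2HasSum (fun (r : ℤ) ω => (c r : ℂ) * expo r ω) (fun ω => (f ω : ℂ)))
    (hbdd : ∃ m M : ℝ, 0 < m ∧ ∀ᵐ ω ∂torusMeasure, m ≤ f ω ∧ f ω ≤ M) :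
    ∃ (σsq : ℝ) (ψ φ : ℕ → ℝ) (Ψ Φ : Torus → ℂ) (φt : ℕ → Torus → ℂ),
      -- the factorization of `f` exists and is unique
      IsSpectralFactorization f σsq ψ φ Ψ Φ ∧
      (∀ (σsq' : ℝ) (ψ' φ' : ℕ → ℝ) (Ψ' Φ' : Torus → ℂ),
        IsSpectralFactorization f σsq' ψ' φ' Ψ' Φ' → σsq' = σsq ∧ ψ' = ψ ∧ φ' = φ) ∧
      IsARTail φ φt ∧
      ∀ g : ℕ → ℂ, IsSqSummable g →
        ∃ h : ℕ → ℂ, IsSqSummable h ∧ SolvesWienerHopf c g h ∧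
          (∀ h' : ℕ → ℂ, IsSqSummable h' → SolvesWienerHopf c g h' → h' = h) ∧
          ∃ H : Torus → ℂ, L2HasSum (fun (j : ℕ) ω => h j * expo j ω) H ∧
            (∃ N : Torus → ℂ,
              L2HasSum (fun (ℓ : ℕ) ω =>
                g ℓ * (expo ℓ ω + star (Ψ ω) * star (φt ℓ ω))) N ∧
              ∀ᵐ ω ∂torusMeasure, H ω = N ω / (f ω : ℂ)) ∧
            (∃ N : Torus → ℂ,
              L2HasSum (fun (ℓ : ℕ) ω =>
                g ℓ * (expo ℓ ω -
                  ∑ s ∈ Finset.Icc 1 ℓ, (φ s : ℂ) * expo ((ℓ : ℤ) - (s : ℤ)) ω)) N ∧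
              ∀ᵐ ω ∂torusMeasure, H ω = (σsq : ℂ)⁻¹ * Φ ω * N ω) := by
  obtain ⟨m, M, hm, hb⟩ := hbdd
  have hfm := memLp_top_of_bounds hf.2.1.1 hm hb
  have hc : ∀ r, fourierCoeff (fun ω => (f ω : ℂ)) r = c r :=
    ((l2HasSum_expo_iff (n := fun r : ℤ => r) (a := fun r => (c r : ℂ))
      Function.injective_id).1 hf).2.1
  obtain ⟨σsq, ψ, φ, Ψ, Φ, h⟩ := exists_isSpectralFactorization hfm hm hb hc
  have hΦ := h.memLp_top_phi hm hb
  have hΦs : MemLp (fun ω => star (Φ ω)) ∞ torusMeasure := hΦ.star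
  have hΨs : MemLp (fun ω => star (Ψ ω)) ∞ torusMeasure := (h.memLp_top_psi hb).star
  refine ⟨σsq, ψ, φ, Ψ, Φ, _, h, fun _ _ _ _ _ h' => h.unique hfm hm hb h', h.isARTail hΦs,
    fun g hg => ?_⟩
  obtain ⟨G, hG⟩ := summable_smul_fourierLp hg
  obtain ⟨hH, hfH, hPG⟩ := h.toeplitz_solution hfm hΦ hΨs hΦs (mem_hardySpace_of_hasSum hG)
  set T : TorusL2 →L[ℂ] TorusL2 := rieszProj ∘L mulL2 _ hΦs with hT
  have hTG : rieszProj (mulL2 _ hΦs G) = T G := rfl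
  rw [hTG] at hH hfH hPG
  set H := (σsq : ℂ)⁻¹ • mulL2 _ hΦ (T G) with hHdef
  have hHsum := hasSum_fourierCoeff_of_mem_hardySpace hH
  have hsolves := (solvesWienerHopf_iff hfm hc hHsum hG).2 (by rw [hfH, hPG])
  have hsq := isSqSummable_fourierCoeff H
  refine ⟨_, hsq, hsolves, fun h' hh' hs' => hsolves.unique hfm hm hb hc hg hsq hh' hs', H,
    (l2HasSum_iff_hasSum (fun j => ae_eq_smul_fourierLp _ _) EventuallyEq.rfl).2 hHsum,
    ⟨(mulL2 _ hΨs ∘L T) G, l2HasSum_of_continuousLinearMap _ hG fun ℓ => ?_, ?_⟩,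
    ⟨T G, l2HasSum_of_continuousLinearMap _ hG fun ℓ => ?_, ?_⟩⟩
  -- The first numerator is fH = Ψ*P(Φ*G). On e_ℓ, P(Φ*e_ℓ) = Φ*e_ℓ + φ_ℓ*, and multiplying by Ψ*
  -- with Ψ*Φ* = 1 gives e_ℓ + Ψ*φ_ℓ*.
  · have hTE : T (fourierLp 2 (ℓ : ℤ)) = rieszProj (mulL2 _ hΦs (fourierLp 2 (ℓ : ℤ))) := rfl
    filter_upwards [coeFn_mulL2 _ hΨs (T (fourierLp 2 (ℓ : ℤ))),
      coeFn_mulL2 _ hΦs (fourierLp 2 (ℓ : ℤ)), coeFn_fourierLp_expo ℓ,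
      Lp.coeFn_sub (T (fourierLp 2 (ℓ : ℤ))) (mulL2 _ hΦs (fourierLp 2 (ℓ : ℤ))), h.phi_eq_inv]
      with ω h1 h2 h3 h4 h5
    have h6 := congrArg star h5
    rw [star_mul, star_one] at h6
    rw [ContinuousLinearMap.comp_apply, h1, ← hTE, h4, Pi.sub_apply, h2, h3, star_star]
    linear_combination -expo ℓ ω * h6
  · rw [ContinuousLinearMap.comp_apply, ← hfH]
    filter_upwards [coeFn_mulL2 _ hfm H, hb] with ω h1 h2
    rw [h1, mul_div_cancel_left₀]
    exact_mod_cast (hm.trans_le h2.1).ne'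
  -- The second numerator is P(Φ*G), whose value on e_ℓ is the finite sum.
  · have hTE : T (fourierLp 2 (ℓ : ℤ)) = _ := h.rieszProj_mulL2_star_phi hΦs ℓ
    rw [hTE]
    have hs : ∀ᵐ ω ∂torusMeasure, ∀ s ∈ Finset.Icc 1 ℓ,
        ((φ s : ℂ) • fourierLp 2 ((ℓ : ℤ) - (s : ℤ)) : TorusL2) ω =
          (φ s : ℂ) * expo ((ℓ : ℤ) - (s : ℤ)) ω :=
      (Finset.eventually_all _).2 fun s _ => (ae_eq_smul_fourierLp _ _).symm
    filter_upwards [hs, coeFn_fourierLp_expo ℓ,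
      Lp.coeFn_sub (fourierLp 2 (ℓ : ℤ) : TorusL2)
        (∑ s ∈ Finset.Icc 1 ℓ, (φ s : ℂ) • fourierLp 2 ((ℓ : ℤ) - (s : ℤ))),
      Lp.coeFn_finsetSum (Finset.Icc 1 ℓ)
        fun s => ((φ s : ℂ) • fourierLp 2 ((ℓ : ℤ) - (s : ℤ)) : TorusL2)] with ω h1 h2 h3 h4
    rw [h3, Pi.sub_apply, h2, h4, Finset.sum_apply, Finset.sum_congr rfl h1]
  · filter_upwards [Lp.coeFn_smul (σsq : ℂ)⁻¹ (mulL2 _ hΦ (T G)), coeFn_mulL2 _ hΦ (T G)]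
      with ω h1 h2
    rw [hHdef, h1, Pi.smul_apply, h2, smul_eq_mul, mul_assoc]
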